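/- Let $\mathcal L$ be the set of formulas built from countably many propositional variables $p_0,p_1,p_2,\dots$ and the constant $\bot$ using implication $\rightarrow$ and a binary modality $\rhd$; put $\neg\phi:=\phi\rightarrow\bot$, $\top:=\neg\bot$, $\phi\vee\psi:=\neg\phi\rightarrow\psi$ and $\phi\wedge\psi:=\neg(\phi\rightarrow\neg\psi)$. The modal logic $\Re_d$ of deterministic partial recursive functions is the smallest set of formulas of $\mathcal L$ that contains all instances, with formulas of $\mathcal L$, of the axioms of classical propositional logic and of the axiom schemes - A1. $\phi\rhd\psi\rightarrow(\chi\rhd\psi\rightarrow(\phi\vee\chi)\rhd\psi)$, - A2. $\bot\rhd\phi$, - A3. $\phi\rhd\top$, - A4. $\phi\rhd\psi\rightarrow(\phi\rhd\chi\rightarrow\phi\rhd(\psi\wedge\chi))$, and is closed under Modus Ponens (from $\phi\rightarrow\psi$ and $\phi$ infer $\psi$) and the monotonicity rule M (from $\phi_1\rightarrow\phi_2$ and $\psi_1\rightarrow\psi_2$ infer $\phi_2\rhd\psi_1\rightarrow\phi_1\rhd\psi_2$). **Corollary.** The logic $\Re_d$ is decidable: there is an algorithm that, given a formula $\phi$ of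 $\mathcal L$, decides whether $\vdash_{\Re_d}\phi$. (That is, under a standard effective Gödel numbering of formulas, the set of theorems of $\Re_d$ is recursive.) -/

import Mathlib

namespace RecFunLogic

/-- Formulas of the modal language: propositional variables `p₀, p₁, p₂, …` and the constant `⊥`,
closed under implication and the binary modality `▷` (here `rhd`). -/
inductive Formula : Type
  | var (n : ℕ) : Formula
  | bot : Formula
  | imp (φ ψ : Formula) : Formula
  | rhd (φ ψ : Formula) : Formula

namespace Formula

/-- `¬φ` is `φ → ⊥`. -/
protected def neg (φ : Formula) : Formula := φ.imp bot

/-- `⊤` is `¬⊥`. -/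
protected def top : Formula := bot.neg

/-- `φ ∨ ψ` is `¬φ → ψ`. -/
protected def or (φ ψ : Formula) : Formula := φ.neg.imp ψ

/-- `φ ∧ ψ` is `¬(φ → ¬ψ)`. -/
protected def and (φ ψ : Formula) : Formula := (φ.imp ψ.neg).neg

/-- The Gödel number of a formula. -/
def toNat : Formula → ℕ
  | bot => 0
  | var n => 3 * n + 1
  | imp φ ψ => 3 * Nat.pair φ.toNat ψ.toNat + 2
  | rhd φ ψ => 3 * Nat.pair φ.toNat ψ.toNat + 3

/-- The formula with a given Gödel number. -/
def ofNat : ℕ → Formula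
  | 0 => bot
  | n + 1 =>
    have h1 : (n / 3).unpair.1 < n + 1 :=
      Nat.lt_succ_of_le ((Nat.unpair_left_le _).trans (Nat.div_le_self _ _))
    have h2 : (n / 3).unpair.2 < n + 1 :=
      Nat.lt_succ_of_le ((Nat.unpair_right_le _).trans (Nat.div_le_self _ _))
    match n % 3 with
    | 0 => var (n / 3)
    | 1 => imp (ofNat (n / 3).unpair.1) (ofNat (n / 3).unpair.2)
    | _ => rhd (ofNat (n / 3).unpair.1) (ofNat (n / 3).unpair.2)

theorem ofNat_toNat (φ : Formula) : ofNat φ.toNat = φ := by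
  induction φ with
  | bot => simp [toNat, ofNat]
  | var n => simp [toNat, ofNat]
  | imp φ ψ ih1 ih2 =>
    have hd : (3 * Nat.pair φ.toNat ψ.toNat + 1) / 3 = Nat.pair φ.toNat ψ.toNat := by omega
    have hm : (3 * Nat.pair φ.toNat ψ.toNat + 1) % 3 = 1 := by omega
    simp [toNat, ofNat, hd, hm, ih1, ih2]
  | rhd φ ψ ih1 ih2 =>
    have hd : (3 * Nat.pair φ.toNat ψ.toNat + 2) / 3 = Nat.pair φ.toNat ψ.toNat := by omega
    have hm : (3 * Nat.pair φ.toNat ψ.toNat + 2) % 3 = 2 := by omega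
    simp [toNat, ofNat, hd, hm, ih1, ih2]

theorem toNat_ofNat (n : ℕ) : (ofNat n).toNat = n := by
  induction n using Nat.strong_induction_on with
  | _ n ih =>
    cases n with
    | zero => simp [toNat, ofNat]
    | succ n =>
      have h1 := ih (n / 3).unpair.1
        (Nat.lt_succ_of_le ((Nat.unpair_left_le _).trans (Nat.div_le_self _ _)))
      have h2 := ih (n / 3).unpair.2
        (Nat.lt_succ_of_le ((Nat.unpair_right_le _).trans (Nat.div_le_self _ _)))
      have hlt : n % 3 < 3 := Nat.mod_lt _ (by norm_num)
      rcases (by omega : n % 3 = 0 ∨ n % 3 = 1 ∨ n % 3 = 2) with h | h | h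
      · simp only [ofNat, h, toNat]; omega
      · simp only [ofNat, h, toNat, h1, h2, Nat.pair_unpair]; omega
      · simp only [ofNat, h, toNat, h1, h2, Nat.pair_unpair]; omega

/-- The explicit Gödel numbering of formulas, with respect to which the computability of
predicates on formulas is understood. -/
instance instDenumerable : Denumerable Formula :=
  Denumerable.mk' ⟨toNat, ofNat, ofNat_toNat, toNat_ofNat⟩

end Formula

/-- `Provable φ`: the formula `φ` is a theorem of the modal logic `ℜ_d` of deterministic partial
recursive functions. The Hilbert calculus consists of an axiomatization of classical propositional
logic (`k`, `s`, `dne`), the axioms `a1`-`a4`, Modus Ponens and the monotonicity rule `mono`. -/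
inductive Provable : Formula → Prop
  | k (φ ψ : Formula) : Provable (φ.imp (ψ.imp φ))
  | s (φ ψ χ : Formula) :
      Provable ((φ.imp (ψ.imp χ)).imp ((φ.imp ψ).imp (φ.imp χ)))
  | dne (φ : Formula) : Provable (φ.neg.neg.imp φ)
  | a1 (φ ψ χ : Formula) :
      Provable ((φ.rhd ψ).imp ((χ.rhd ψ).imp ((φ.or χ).rhd ψ)))
  | a2 (φ : Formula) : Provable (Formula.bot.rhd φ)
  | a3 (φ : Formula) : Provable (φ.rhd Formula.top)
  | a4 (φ ψ χ : Formula) :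
      Provable ((φ.rhd ψ).imp ((φ.rhd χ).imp (φ.rhd (ψ.and χ))))
  | mp {φ ψ : Formula} : Provable (φ.imp ψ) → Provable φ → Provable ψ
  | mono {φ₁ φ₂ ψ₁ ψ₂ : Formula} : Provable (φ₁.imp φ₂) → Provable (ψ₁.imp ψ₂) →
      Provable ((φ₂.rhd ψ₁).imp (φ₁.rhd ψ₂))

end RecFunLogic

/-!
Theories are closed under adjoining a formula (the deduction theorem), so Zorn's lemma extends every
theory omitting a formula to a maximal consistent set omitting it. Given a maximal consistent set
`w` omitting `α ▷ β`, axioms A1 and A2 make the formulas `φ` with `¬φ ▷ β ∈ w` a theory, which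
extends to a maximal consistent `x` containing `α`; axioms A3 and A4 make the formulas `ψ` with
`γ ▷ ψ ∈ w` for some `γ ∈ x` a theory, which extends to a maximal consistent `y` omitting `β`.
Hence `ℜ_d` is complete for models with a ternary accessibility relation.

Filtration cuts a countermodel down to the finitely many sets of formulas of Gödel number below `n`
realized in it. Such a set is coded by a number below `2 ^ n` and a family of them by a number below
`2 ^ 2 ^ n`, so a formula is unprovable iff a search with a primitive recursive bound finds a
countermodel.
-/

namespace RecFunLogic

open Formula

/-! ### Theories and maximal consistent sets -/

/-- A theory is a set of formulas that contains all theorems of `ℜ_d` and is closed under Modus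
Ponens (the monotonicity rule is not required to preserve membership). -/
structure IsTheory (T : Set Formula) : Prop where
  provable_mem {φ : Formula} : Provable φ → φ ∈ T
  mp_mem {φ ψ : Formula} : φ.imp ψ ∈ T → φ ∈ T → ψ ∈ T

/-- The set of consequences of a theory `T` and one further formula `φ`. By the deduction theorem
these are the `ψ` for which `φ → ψ` belongs to `T`, which is taken as the definition. -/
def adjoin (T : Set Formula) (φ : Formula) : Set Formula := {ψ | φ.imp ψ ∈ T}

theorem Provable.imp_self (φ : Formula) : Provable (φ.imp φ) :=
  .mp (.mp (.s φ (φ.imp φ) φ) (.k φ (φ.imp φ))) (.k φ φ)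

theorem isTheory_setOf_provable : IsTheory {φ | Provable φ} := ⟨id, .mp⟩

namespace IsTheory

variable {T : Set Formula} {φ ψ : Formula}

theorem imp_mem_of_mem (hT : IsTheory T) (hψ : ψ ∈ T) : φ.imp ψ ∈ T :=
  hT.mp_mem (hT.provable_mem (.k ψ φ)) hψ

theorem mem_of_bot_mem (hT : IsTheory T) (hbot : bot ∈ T) : φ ∈ T :=
  hT.mp_mem (hT.provable_mem (.dne φ)) (hT.imp_mem_of_mem hbot)

theorem mem_adjoin_self (hT : IsTheory T) : φ ∈ adjoin T φ :=
  hT.provable_mem (.imp_self φ)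

theorem subset_adjoin (hT : IsTheory T) : T ⊆ adjoin T φ :=
  fun _ ↦ hT.imp_mem_of_mem

theorem isTheory_adjoin (hT : IsTheory T) : IsTheory (adjoin T φ) where
  provable_mem h := hT.imp_mem_of_mem (hT.provable_mem h)
  mp_mem h₁ h₂ := hT.mp_mem (hT.mp_mem (hT.provable_mem (.s _ _ _)) h₁) h₂

theorem sUnion {c : Set (Set Formula)} (hc : ∀ T ∈ c, IsTheory T) (hchain : IsChain (· ⊆ ·) c)
    (hne : c.Nonempty) : IsTheory (⋃₀ c) where
  provable_mem h := ⟨_, hne.some_mem, (hc _ hne.some_mem).provable_mem h⟩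
  mp_mem := by
    rintro φ ψ ⟨T, hT, himp⟩ ⟨U, hU, hφ⟩
    rcases hchain.total hT hU with hTU | hUT
    · exact ⟨U, hU, (hc U hU).mp_mem (hTU himp) hφ⟩
    · exact ⟨T, hT, (hc T hT).mp_mem himp (hUT hφ)⟩

end IsTheory

/-- Maximal consistent sets, the worlds of the canonical model: theories that are maximal among
those not containing `⊥`. -/
def IsMaximalConsistent (x : Set Formula) : Prop :=
  Maximal (fun T ↦ IsTheory T ∧ bot ∉ T) x

theorem IsTheory.exists_isMaximalConsistent_of_bot_notMem {T : Set Formula} (hT : IsTheory T)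
    (hbot : bot ∉ T) : ∃ x, IsMaximalConsistent x ∧ T ⊆ x := by
  obtain ⟨x, hTx, hx⟩ := zorn_subset_nonempty {T | IsTheory T ∧ bot ∉ T}
    (fun c hc hchain hne ↦ ⟨⋃₀ c, ⟨.sUnion (fun T hT ↦ (hc hT).1) hchain hne,
      fun ⟨U, hU, hbotU⟩ ↦ (hc hU).2 hbotU⟩, fun _ ↦ Set.subset_sUnion_of_mem⟩) T ⟨hT, hbot⟩
  exact ⟨x, hx, hTx⟩

namespace IsMaximalConsistent

variable {x : Set Formula} {φ ψ : Formula}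

theorem isTheory (hx : IsMaximalConsistent x) : IsTheory x := hx.prop.1

theorem bot_notMem (hx : IsMaximalConsistent x) : bot ∉ x := hx.prop.2

theorem neg_mem (hx : IsMaximalConsistent x) : φ.neg ∈ x ↔ φ ∉ x := by
  refine ⟨fun hneg hφ ↦ hx.bot_notMem (hx.isTheory.mp_mem hneg hφ), fun hφ ↦ ?_⟩
  by_contra hneg
  exact hφ (hx.le_of_ge ⟨hx.isTheory.isTheory_adjoin, hneg⟩ hx.isTheory.subset_adjoin
    hx.isTheory.mem_adjoin_self)

theorem imp_mem (hx : IsMaximalConsistent x) : φ.imp ψ ∈ x ↔ (φ ∈ x → ψ ∈ x) := by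
  refine ⟨hx.isTheory.mp_mem, fun h ↦ ?_⟩
  by_cases hφ : φ ∈ x
  · exact hx.isTheory.imp_mem_of_mem (h hφ)
  · have hbot : bot ∈ adjoin x φ := hx.neg_mem.2 hφ
    exact hx.isTheory.isTheory_adjoin.mem_of_bot_mem hbot

theorem or_mem (hx : IsMaximalConsistent x) : φ.or ψ ∈ x ↔ φ ∈ x ∨ ψ ∈ x := by
  rw [Formula.or, hx.imp_mem, hx.neg_mem, or_iff_not_imp_left]

theorem and_mem (hx : IsMaximalConsistent x) : φ.and ψ ∈ x ↔ φ ∈ x ∧ ψ ∈ x := by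
  simp only [Formula.and, hx.imp_mem, hx.neg_mem, Classical.not_imp, not_not]

theorem rhd_mem_of_imp {φ₁ φ₂ ψ₁ ψ₂ : Formula} (hx : IsMaximalConsistent x)
    (hφ : Provable (φ₁.imp φ₂)) (hψ : Provable (ψ₁.imp ψ₂)) (h : φ₂.rhd ψ₁ ∈ x) :
    φ₁.rhd ψ₂ ∈ x :=
  hx.isTheory.mp_mem (hx.isTheory.provable_mem (.mono hφ hψ)) h

end IsMaximalConsistent

theorem IsTheory.exists_isMaximalConsistent {T : Set Formula} {β : Formula} (hT : IsTheory T)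
    (hβ : β ∉ T) : ∃ x, IsMaximalConsistent x ∧ T ⊆ x ∧ β ∉ x := by
  have hbot : bot ∉ adjoin T β.neg := fun h ↦ hβ (hT.mp_mem (hT.provable_mem (.dne β)) h)
  obtain ⟨x, hx, hsub⟩ := hT.isTheory_adjoin.exists_isMaximalConsistent_of_bot_notMem hbot
  exact ⟨x, hx, hT.subset_adjoin.trans hsub, hx.neg_mem.1 (hsub hT.mem_adjoin_self)⟩

theorem Provable.of_forall_mem {φ : Formula} (h : ∀ x, IsMaximalConsistent x → φ ∈ x) :
    Provable φ := by
  by_contra hφ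
  obtain ⟨x, hx, -, hφx⟩ := isTheory_setOf_provable.exists_isMaximalConsistent hφ
  exact hφx (h x hx)

namespace IsMaximalConsistent

variable {w x : Set Formula} {α β : Formula}

theorem isTheory_setOf_neg_rhd_mem (hw : IsMaximalConsistent w) :
    IsTheory {φ | φ.neg.rhd β ∈ w} where
  provable_mem {φ} hφ := by
    have hbot : Provable (φ.neg.imp bot) := .of_forall_mem fun z hz ↦ by
      simp only [hz.imp_mem, hz.neg_mem, hz.isTheory.provable_mem hφ, not_true, false_imp_iff]
    exact hw.rhd_mem_of_imp hbot (.imp_self β) (hw.isTheory.provable_mem (.a2 β))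
  mp_mem {φ ψ} h₁ h₂ := by
    have hor : ((φ.imp ψ).neg.or φ.neg).rhd β ∈ w :=
      hw.isTheory.mp_mem (hw.isTheory.mp_mem (hw.isTheory.provable_mem (.a1 _ _ _)) h₁) h₂
    refine hw.rhd_mem_of_imp (.of_forall_mem fun z hz ↦ ?_) (.imp_self β) hor
    simp only [hz.imp_mem, hz.neg_mem, hz.or_mem]
    tauto

theorem isTheory_setOf_exists_rhd_mem (hw : IsMaximalConsistent w) (hx : IsMaximalConsistent x) :
    IsTheory {ψ | ∃ γ ∈ x, γ.rhd ψ ∈ w} where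
  provable_mem {ψ} hψ :=
    ⟨Formula.top, hx.isTheory.provable_mem (.imp_self bot),
      hw.rhd_mem_of_imp (.imp_self _) (.mp (.k ψ _) hψ) (hw.isTheory.provable_mem (.a3 _))⟩
  mp_mem := by
    rintro φ ψ ⟨γ, hγ, h₁⟩ ⟨δ, hδ, h₂⟩
    have hleft : (γ.and δ).rhd (φ.imp ψ) ∈ w :=
      hw.rhd_mem_of_imp (.of_forall_mem fun _ hz ↦ hz.imp_mem.2 fun h ↦ (hz.and_mem.1 h).1)
        (.imp_self _) h₁
    have hright : (γ.and δ).rhd φ ∈ w :=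
      hw.rhd_mem_of_imp (.of_forall_mem fun _ hz ↦ hz.imp_mem.2 fun h ↦ (hz.and_mem.1 h).2)
        (.imp_self _) h₂
    have hand : (γ.and δ).rhd ((φ.imp ψ).and φ) ∈ w :=
      hw.isTheory.mp_mem (hw.isTheory.mp_mem (hw.isTheory.provable_mem (.a4 _ _ _)) hleft) hright
    refine ⟨γ.and δ, hx.and_mem.2 ⟨hγ, hδ⟩,
      hw.rhd_mem_of_imp (.imp_self _) (.of_forall_mem fun z hz ↦ ?_) hand⟩
    rw [hz.imp_mem, hz.and_mem, hz.imp_mem]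
    exact fun h ↦ h.1 h.2

theorem exists_mem_notMem_of_rhd_notMem (hw : IsMaximalConsistent w) (h : α.rhd β ∉ w) :
    ∃ x y, IsMaximalConsistent x ∧ IsMaximalConsistent y ∧
      (∀ φ ψ, φ.rhd ψ ∈ w → φ ∈ x → ψ ∈ y) ∧ α ∈ x ∧ β ∉ y := by
  have hα : α.neg ∉ {φ | φ.neg.rhd β ∈ w} := fun hα ↦
    h (hw.rhd_mem_of_imp (.of_forall_mem fun z hz ↦ by
      simp only [hz.imp_mem, hz.neg_mem, not_not, imp_self]) (.imp_self β) hα)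
  obtain ⟨x, hx, hsubx, hαx⟩ := hw.isTheory_setOf_neg_rhd_mem.exists_isMaximalConsistent hα
  have hβ : β ∉ {ψ | ∃ γ ∈ x, γ.rhd ψ ∈ w} := by
    rintro ⟨γ, hγ, hγβ⟩
    exact hx.neg_mem.1 (hsubx (hw.rhd_mem_of_imp (.dne γ) (.imp_self β) hγβ)) hγ
  obtain ⟨y, hy, hsuby, hβy⟩ :=
    (hw.isTheory_setOf_exists_rhd_mem hx).exists_isMaximalConsistent hβ
  exact ⟨x, y, hx, hy, fun φ ψ hφψ hφ ↦ hsuby ⟨φ, hφ, hφψ⟩,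
    not_not.1 (mt hx.neg_mem.2 hαx), hβy⟩

end IsMaximalConsistent

/-! ### Soundness and completeness -/

/-- A model for the language of `ℜ_d` on the set of worlds `W`. One may read `Rel w x y` as "the
program `w` can turn the input `x` into the output `y`"; no functionality is imposed. -/
structure Model (W : Type*) where
  Rel : W → W → W → Prop
  Val : W → ℕ → Prop

/-- Truth of a formula at a world of a model. -/
def Model.Satisfies {W : Type*} (M : Model W) (w : W) : Formula → Prop
  | var i => M.Val w i
  | bot => False
  | imp φ ψ => M.Satisfies w φ → M.Satisfies w ψ
  | rhd φ ψ => ∀ x y, M.Rel w x y → M.Satisfies x φ → M.Satisfies y ψ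

theorem Provable.satisfies {W : Type*} (M : Model W) {φ : Formula} (h : Provable φ) (w : W) :
    M.Satisfies w φ := by
  induction h generalizing w with
  | k φ ψ => exact fun hφ _ ↦ hφ
  | s φ ψ χ => exact fun h₁ h₂ hφ ↦ h₁ hφ (h₂ hφ)
  | dne φ => exact fun h ↦ by_contra h
  | a1 φ ψ χ =>
    intro h₁ h₂ x y hR hor
    by_cases hφ : M.Satisfies x φ
    · exact h₁ x y hR hφ
    · exact h₂ x y hR (hor hφ)
  | a2 φ => exact fun _ _ _ h ↦ h.elim
  | a3 φ => exact fun _ _ _ _ h ↦ h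
  | a4 φ ψ χ => exact fun h₁ h₂ x y hR hφ h ↦ h (h₁ x y hR hφ) (h₂ x y hR hφ)
  | mp _ _ ih₁ ih₂ => exact ih₁ w (ih₂ w)
  | mono _ _ ih₁ ih₂ => exact fun h x y hR hφ ↦ ih₂ y (h x y hR (ih₁ x hφ))

/-- The canonical model, in which truth at a maximal consistent set is membership in it. -/
def canonicalModel : Model {x // IsMaximalConsistent x} where
  Rel w x y := ∀ φ ψ, φ.rhd ψ ∈ w.1 → φ ∈ x.1 → ψ ∈ y.1
  Val w i := var i ∈ w.1

theorem canonicalModel_satisfies_iff {φ : Formula} (w : {x // IsMaximalConsistent x}) :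
    canonicalModel.Satisfies w φ ↔ φ ∈ w.1 := by
  induction φ generalizing w with
  | var i => exact Iff.rfl
  | bot => exact (iff_false_intro w.2.bot_notMem).symm
  | imp φ ψ ihφ ihψ => rw [Model.Satisfies, ihφ, ihψ, w.2.imp_mem]
  | rhd φ ψ ihφ ihψ =>
    simp only [Model.Satisfies, ihφ, ihψ]
    refine ⟨fun h ↦ ?_, fun h x y hR ↦ hR φ ψ h⟩
    by_contra hnot
    obtain ⟨x, y, hx, hy, hR, hφ, hψ⟩ := w.2.exists_mem_notMem_of_rhd_notMem hnot
    exact hψ (h ⟨x, hx⟩ ⟨y, hy⟩ hR hφ)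

theorem provable_iff_forall_satisfies {φ : Formula} :
    Provable φ ↔ ∀ (W : Type) (M : Model W) (w : W), M.Satisfies w φ :=
  ⟨fun h _ M ↦ h.satisfies M, fun h ↦ .of_forall_mem fun x hx ↦
    (canonicalModel_satisfies_iff ⟨x, hx⟩).1 (h _ canonicalModel ⟨x, hx⟩)⟩

/-! ### Finite countermodels coded by numbers -/

open Classical in
/-- The number coding the finite set `S ∩ [0, n)`: its binary digit at position `i < n` is `1` iff
`i ∈ S`. -/
noncomputable def bitCode (n : ℕ) (S : Set ℕ) : ℕ :=
  Nat.ofBits fun i : Fin n ↦ decide (i.1 ∈ S)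

theorem bitCode_lt (n : ℕ) (S : Set ℕ) : bitCode n S < 2 ^ n := Nat.ofBits_lt_two_pow _

theorem testBit_bitCode {n i : ℕ} {S : Set ℕ} : (bitCode n S).testBit i ↔ i < n ∧ i ∈ S := by
  by_cases hi : i < n <;> simp [bitCode, hi, Nat.testBit_ofBits_ge, not_lt.1]

/-- A number `v` codes a set of formulas: `Holds v φ` says that `φ` belongs to it, that is, that the
binary digit of `v` at the Gödel number of `φ` is `1`. -/
def Holds (v : ℕ) (φ : Formula) : Prop := v.testBit φ.toNat

theorem Holds.toNat_lt {v : ℕ} {φ : Formula} (h : Holds v φ) : φ.toNat < v :=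
  Nat.lt_two_pow_self.trans_le (Nat.ge_two_pow_of_testBit h)

theorem encode_pair_lt_toNat_imp (φ ψ : Formula) : Encodable.encode (φ, ψ) < (φ.imp ψ).toNat := by
  change Nat.pair φ.toNat ψ.toNat < 3 * Nat.pair φ.toNat ψ.toNat + 2
  omega

theorem encode_pair_lt_toNat_rhd (φ ψ : Formula) : Encodable.encode (φ, ψ) < (φ.rhd ψ).toNat := by
  change Nat.pair φ.toNat ψ.toNat < 3 * Nat.pair φ.toNat ψ.toNat + 3
  omega

theorem toNat_lt_of_toNat_imp_lt {n : ℕ} {φ ψ : Formula} (h : (φ.imp ψ).toNat < n) :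
    φ.toNat < n ∧ ψ.toNat < n :=
  have hpair := (encode_pair_lt_toNat_imp φ ψ).trans h
  ⟨(Nat.left_le_pair _ _).trans_lt hpair, (Nat.right_le_pair _ _).trans_lt hpair⟩

theorem toNat_lt_of_toNat_rhd_lt {n : ℕ} {φ ψ : Formula} (h : (φ.rhd ψ).toNat < n) :
    φ.toNat < n ∧ ψ.toNat < n :=
  have hpair := (encode_pair_lt_toNat_rhd φ ψ).trans h
  ⟨(Nat.left_le_pair _ _).trans_lt hpair, (Nat.right_le_pair _ _).trans_lt hpair⟩

/-- The accessibility relation of the canonical model, for coded sets of formulas. -/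
def Access (v x y : ℕ) : Prop :=
  ∀ φ ψ, Holds v (φ.rhd ψ) → Holds x φ → Holds y ψ

/-- The failure of `φ ▷ ψ` at `v` is witnessed by members of the family `T` of coded sets below
`2 ^ n`. -/
def HasWitness (n T v : ℕ) (φ ψ : Formula) : Prop :=
  ∃ x < 2 ^ n, ∃ y < 2 ^ n,
    T.testBit x ∧ T.testBit y ∧ Access v x y ∧ Holds x φ ∧ ¬ Holds y ψ

/-- The coded set `v` obeys the truth conditions of all formulas with Gödel numbers below `n`, the
worlds being the members of the family `T`. -/
structure Coherent (n T v : ℕ) : Prop where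
  not_holds_bot : ¬ Holds v bot
  holds_imp : ∀ φ ψ, (φ.imp ψ).toNat < n → (Holds v (φ.imp ψ) ↔ (Holds v φ → Holds v ψ))
  hasWitness : ∀ φ ψ, (φ.rhd ψ).toNat < n → ¬ Holds v (φ.rhd ψ) → HasWitness n T v φ ψ

/-- A family `T` of coded sets is coherent if all its members below `2 ^ n` are. -/
def CoherentFamily (n T : ℕ) : Prop := ∀ v < 2 ^ n, T.testBit v → Coherent n T v

/-- The finite model coded by a family `T` of sets of formulas. -/
def codedModel (n T : ℕ) : Model {v // v < 2 ^ n ∧ T.testBit v} where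
  Rel w x y := Access w x y
  Val w i := Holds w (var i)

theorem codedModel_satisfies_iff {n T : ℕ} (hT : CoherentFamily n T) {φ : Formula}
    (hφ : φ.toNat < n) (v : {v // v < 2 ^ n ∧ T.testBit v}) :
    (codedModel n T).Satisfies v φ ↔ Holds v φ := by
  have hv (v : {v // v < 2 ^ n ∧ T.testBit v}) : Coherent n T v := hT v v.2.1 v.2.2
  induction φ generalizing v with
  | var i => exact Iff.rfl
  | bot => exact (iff_false_intro (hv v).not_holds_bot).symm
  | imp φ ψ ihφ ihψ =>
    have hlt := toNat_lt_of_toNat_imp_lt hφ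
    simp only [Model.Satisfies, ihφ hlt.1, ihψ hlt.2, (hv v).holds_imp φ ψ hφ]
  | rhd φ ψ ihφ ihψ =>
    have hlt := toNat_lt_of_toNat_rhd_lt hφ
    simp only [Model.Satisfies, ihφ hlt.1, ihψ hlt.2]
    refine ⟨fun h ↦ ?_, fun h x y hR ↦ hR φ ψ h⟩
    by_contra hnot
    obtain ⟨x, hx, y, hy, hTx, hTy, hR, hxφ, hyψ⟩ := (hv v).hasWitness φ ψ hφ hnot
    exact hyψ (h ⟨x, hx, hTx⟩ ⟨y, hy, hTy⟩ hR hxφ)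

namespace Model

variable {W : Type*} (M : Model W) (n : ℕ)

/-- The number coding the set of the formulas with Gödel numbers below `n` true at `w`. -/
noncomputable def typeCode (w : W) : ℕ := bitCode n {i | M.Satisfies w (ofNat i)}

/-- The number coding the family of the sets `M.typeCode n w`, which are the worlds of the
filtration of `M` through the formulas with Gödel numbers below `n`. -/
noncomputable def filtrationCode : ℕ := bitCode (2 ^ n) (Set.range (M.typeCode n))

variable {M n}

theorem holds_typeCode {w : W} {φ : Formula} :
    Holds (M.typeCode n w) φ ↔ φ.toNat < n ∧ M.Satisfies w φ := by
  rw [Holds, typeCode, testBit_bitCode, Set.mem_ofPred_eq, ofNat_toNat]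

theorem typeCode_lt (w : W) : M.typeCode n w < 2 ^ n := bitCode_lt _ _

theorem testBit_filtrationCode {v : ℕ} :
    (M.filtrationCode n).testBit v ↔ v ∈ Set.range (M.typeCode n) := by
  rw [filtrationCode, testBit_bitCode, and_iff_right_iff_imp]
  rintro ⟨w, rfl⟩
  exact typeCode_lt w

theorem access_typeCode {w x y : W} (h : M.Rel w x y) :
    Access (M.typeCode n w) (M.typeCode n x) (M.typeCode n y) := by
  simp only [Access, holds_typeCode]
  rintro φ ψ ⟨hlt, hw⟩ ⟨-, hx⟩
  exact ⟨(toNat_lt_of_toNat_rhd_lt hlt).2, hw x y h hx⟩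

theorem coherent_typeCode (w : W) : Coherent n (M.filtrationCode n) (M.typeCode n w) where
  not_holds_bot h := (holds_typeCode.1 h).2
  holds_imp φ ψ hlt := by
    obtain ⟨hφ, hψ⟩ := toNat_lt_of_toNat_imp_lt hlt
    simp only [holds_typeCode, hlt, hφ, hψ, true_and, Satisfies]
  hasWitness φ ψ hlt hnot := by
    simp only [holds_typeCode, hlt, true_and, Satisfies, not_forall] at hnot
    obtain ⟨x, y, hR, hxφ, hyψ⟩ := hnot
    exact ⟨M.typeCode n x, typeCode_lt x, M.typeCode n y, typeCode_lt y,
      testBit_filtrationCode.2 ⟨x, rfl⟩, testBit_filtrationCode.2 ⟨y, rfl⟩, access_typeCode hR,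
      holds_typeCode.2 ⟨(toNat_lt_of_toNat_rhd_lt hlt).1, hxφ⟩, fun h ↦ hyψ (holds_typeCode.1 h).2⟩

theorem coherentFamily_filtrationCode : CoherentFamily n (M.filtrationCode n) := by
  rintro v - hv
  obtain ⟨w, rfl⟩ := testBit_filtrationCode.1 hv
  exact coherent_typeCode w

end Model

/-- Some member of some coherent family of coded sets omits `φ`. Gödel numbers up to that of `φ`
suffice, since every formula has a larger Gödel number than its components. -/
def HasCodedCountermodel (φ : Formula) : Prop :=
  ∃ T < 2 ^ 2 ^ (φ.toNat + 1), CoherentFamily (φ.toNat + 1) T ∧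
    ∃ v < 2 ^ (φ.toNat + 1), T.testBit v ∧ ¬ Holds v φ

theorem not_provable_iff_hasCodedCountermodel {φ : Formula} :
    ¬ Provable φ ↔ HasCodedCountermodel φ := by
  constructor
  · simp only [provable_iff_forall_satisfies, not_forall]
    rintro ⟨W, M, w, hw⟩
    exact ⟨M.filtrationCode _, bitCode_lt _ _, M.coherentFamily_filtrationCode,
      M.typeCode _ w, M.typeCode_lt w, M.testBit_filtrationCode.2 ⟨w, rfl⟩,
      fun h ↦ hw (M.holds_typeCode.1 h).2⟩
  · rintro ⟨T, -, hT, v, hv, hTv, hφ⟩ hp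
    exact hφ ((codedModel_satisfies_iff hT (Nat.lt_succ_self _) ⟨v, hv, hTv⟩).1 (hp.satisfies _ _))

/-! ### Primitive recursiveness of the search -/

section Primrec

variable {α β : Type*} [Primcodable α] [Primcodable β]

theorem primrecPred_imp {p q : α → Prop} (hp : PrimrecPred p) (hq : PrimrecPred q) :
    PrimrecPred fun a ↦ p a → q a :=
  (hp.not.or hq).of_eq fun _ ↦ imp_iff_not_or.symm

theorem primrecPred_iff {p q : α → Prop} (hp : PrimrecPred p) (hq : PrimrecPred q) :
    PrimrecPred fun a ↦ (p a ↔ q a) :=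
  ((primrecPred_imp hp hq).and (primrecPred_imp hq hp)).of_eq fun _ ↦
    iff_iff_implies_and_implies.symm

theorem primrecPred_forall_encode_lt {p : α → β → Prop} {f : α → ℕ} (hf : Primrec f)
    (hp : PrimrecPred fun q : α × β ↦ p q.1 q.2) :
    PrimrecPred fun a ↦ ∀ b, Encodable.encode b < f a → p a b := by
  have hlist : Primrec fun a ↦ (List.range (f a)).filterMap (Encodable.decode₂ β) :=
    Primrec.listFilterMap (Primrec.list_range.comp hf) (Primrec.decode₂.comp .snd)
  have hswap : PrimrecRel fun (b : β) (a : α) ↦ p a b := hp.comp (Primrec.pair .snd .fst)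
  refine (hswap.forall_mem_list.comp hlist .id).of_eq fun a ↦ ?_
  simp only [List.mem_filterMap, List.mem_range, Encodable.decode₂_eq_some, id]
  exact ⟨fun h b hb ↦ h b ⟨_, hb, rfl⟩, fun h b ⟨_, hlt, hb⟩ ↦ h b (hb ▸ hlt)⟩

theorem primrecPred_forall_lt {p : α → ℕ → Prop} {f : α → ℕ} (hf : Primrec f)
    (hp : PrimrecPred fun q : α × ℕ ↦ p q.1 q.2) : PrimrecPred fun a ↦ ∀ x < f a, p a x :=
  primrecPred_forall_encode_lt hf hp

theorem primrecPred_exists_lt {p : α → ℕ → Prop} {f : α → ℕ} (hf : Primrec f)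
    (hp : PrimrecPred fun q : α × ℕ ↦ p q.1 q.2) : PrimrecPred fun a ↦ ∃ x < f a, p a x :=
  (primrecPred_forall_lt (p := fun a x ↦ ¬ p a x) hf hp.not).not.of_eq fun _ ↦ by
    simp only [not_forall, not_not, exists_prop]

theorem primrec_two_pow : Primrec fun n : ℕ ↦ 2 ^ n :=
  (Primrec₂.unpaired'.1 Nat.Primrec.pow).comp (.const 2) .id

theorem primrecRel_testBit : PrimrecRel fun m i : ℕ ↦ m.testBit i = true :=
  (Primrec.eq.comp (Primrec.nat_mod.comp (Primrec.nat_div.comp .fst (primrec_two_pow.comp .snd))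
    (.const 2)) (.const 1)).of_eq fun _ ↦ by simp [Nat.testBit_eq_decide_div_mod_eq]

theorem primrec_toNat : Primrec Formula.toNat := Primrec.encode

theorem primrec_imp : Primrec₂ Formula.imp :=
  Primrec.encode_iff.1 (Primrec.nat_add.comp (Primrec.nat_mul.comp (.const 3)
    (Primrec₂.natPair.comp (primrec_toNat.comp .fst) (primrec_toNat.comp .snd))) (.const 2))

theorem primrec_rhd : Primrec₂ Formula.rhd :=
  Primrec.encode_iff.1 (Primrec.nat_add.comp (Primrec.nat_mul.comp (.const 3)
    (Primrec₂.natPair.comp (primrec_toNat.comp .fst) (primrec_toNat.comp .snd))) (.const 3))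

theorem primrecRel_holds : PrimrecRel Holds :=
  primrecRel_testBit.comp .fst (primrec_toNat.comp .snd)

variable {n T v x y : α → ℕ} {φ ψ : α → Formula}

theorem primrecPred_access (hv : Primrec v) (hx : Primrec x) (hy : Primrec y) :
    PrimrecPred fun a ↦ Access (v a) (x a) (y a) := by
  have hleft : Primrec fun q : α × Formula × Formula ↦ q.2.1 := Primrec.fst.comp .snd
  have hright : Primrec fun q : α × Formula × Formula ↦ q.2.2 := Primrec.snd.comp .snd
  have hbounded : PrimrecPred fun a ↦ ∀ q : Formula × Formula, Encodable.encode q < v a →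
      Holds (v a) (q.1.rhd q.2) → Holds (x a) q.1 → Holds (y a) q.2 :=
    primrecPred_forall_encode_lt hv <|
      primrecPred_imp (primrecRel_holds.comp (hv.comp .fst) (primrec_rhd.comp hleft hright)) <|
        primrecPred_imp (primrecRel_holds.comp (hx.comp .fst) hleft)
          (primrecRel_holds.comp (hy.comp .fst) hright)
  exact hbounded.of_eq fun a ↦
    ⟨fun h φ ψ hφψ ↦ h (φ, ψ) ((encode_pair_lt_toNat_rhd φ ψ).trans hφψ.toNat_lt) hφψ,
      fun h q _ ↦ h q.1 q.2⟩

theorem primrecPred_hasWitness (hn : Primrec n) (hT : Primrec T) (hv : Primrec v)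
    (hφ : Primrec φ) (hψ : Primrec ψ) :
    PrimrecPred fun a ↦ HasWitness (n a) (T a) (v a) (φ a) (ψ a) := by
  have ha : Primrec fun q : (α × ℕ) × ℕ ↦ q.1.1 := Primrec.fst.comp .fst
  have hx : Primrec fun q : (α × ℕ) × ℕ ↦ q.1.2 := Primrec.snd.comp .fst
  refine primrecPred_exists_lt (primrec_two_pow.comp hn) <|
    primrecPred_exists_lt (primrec_two_pow.comp (hn.comp .fst)) ?_
  exact (primrecRel_testBit.comp (hT.comp ha) hx).and <|
    (primrecRel_testBit.comp (hT.comp ha) .snd).and <|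
    (primrecPred_access (hv.comp ha) hx .snd).and <|
    (primrecRel_holds.comp hx (hφ.comp ha)).and (primrecRel_holds.comp .snd (hψ.comp ha)).not

theorem primrecPred_forall_toNat_lt {op : Formula → Formula → Formula} (hop : Primrec₂ op)
    (hlt : ∀ φ ψ, Encodable.encode (φ, ψ) < (op φ ψ).toNat) {p : α → Formula → Formula → Prop}
    (hn : Primrec n) (hp : PrimrecPred fun q : α × Formula × Formula ↦ p q.1 q.2.1 q.2.2) :
    PrimrecPred fun a ↦ ∀ φ ψ, (op φ ψ).toNat < n a → p a φ ψ := by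
  have hguard : PrimrecPred fun q : α × Formula × Formula ↦ (op q.2.1 q.2.2).toNat < n q.1 :=
    Primrec.nat_lt.comp (primrec_toNat.comp (hop.comp (Primrec.fst.comp .snd)
      (Primrec.snd.comp .snd))) (hn.comp .fst)
  have hbounded : PrimrecPred fun a ↦ ∀ q : Formula × Formula, Encodable.encode q < n a →
      (op q.1 q.2).toNat < n a → p a q.1 q.2 :=
    primrecPred_forall_encode_lt hn (primrecPred_imp hguard hp)
  exact hbounded.of_eq fun a ↦
    ⟨fun h φ ψ hφψ ↦ h (φ, ψ) ((hlt φ ψ).trans hφψ) hφψ, fun h q _ ↦ h q.1 q.2⟩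

theorem primrecPred_coherent (hn : Primrec n) (hT : Primrec T) (hv : Primrec v) :
    PrimrecPred fun a ↦ Coherent (n a) (T a) (v a) := by
  have hleft : Primrec fun q : α × Formula × Formula ↦ q.2.1 := Primrec.fst.comp .snd
  have hright : Primrec fun q : α × Formula × Formula ↦ q.2.2 := Primrec.snd.comp .snd
  have hv' : Primrec fun q : α × Formula × Formula ↦ v q.1 := hv.comp .fst
  have hbot := (primrecRel_holds.comp hv (.const bot)).not
  have himp : PrimrecPred fun a ↦ ∀ φ ψ, (φ.imp ψ).toNat < n a →
      (Holds (v a) (φ.imp ψ) ↔ (Holds (v a) φ → Holds (v a) ψ)) :=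
    primrecPred_forall_toNat_lt primrec_imp encode_pair_lt_toNat_imp hn <|
      primrecPred_iff (primrecRel_holds.comp hv' (primrec_imp.comp hleft hright)) <|
        primrecPred_imp (primrecRel_holds.comp hv' hleft) (primrecRel_holds.comp hv' hright)
  have hrhd : PrimrecPred fun a ↦ ∀ φ ψ, (φ.rhd ψ).toNat < n a →
      ¬ Holds (v a) (φ.rhd ψ) → HasWitness (n a) (T a) (v a) φ ψ :=
    primrecPred_forall_toNat_lt primrec_rhd encode_pair_lt_toNat_rhd hn <|
      primrecPred_imp (primrecRel_holds.comp hv' (primrec_rhd.comp hleft hright)).not <|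
        primrecPred_hasWitness (hn.comp .fst) (hT.comp .fst) hv' hleft hright
  exact (hbot.and (himp.and hrhd)).of_eq fun a ↦
    ⟨fun ⟨h₁, h₂, h₃⟩ ↦ ⟨h₁, h₂, h₃⟩, fun ⟨h₁, h₂, h₃⟩ ↦ ⟨h₁, h₂, h₃⟩⟩

theorem primrecPred_coherentFamily (hn : Primrec n) (hT : Primrec T) :
    PrimrecPred fun a ↦ CoherentFamily (n a) (T a) :=
  primrecPred_forall_lt (primrec_two_pow.comp hn) <|
    primrecPred_imp (primrecRel_testBit.comp (hT.comp .fst) .snd)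
      (primrecPred_coherent (hn.comp .fst) (hT.comp .fst) .snd)

end Primrec

theorem primrecPred_hasCodedCountermodel : PrimrecPred HasCodedCountermodel := by
  have hn : Primrec fun φ : Formula ↦ φ.toNat + 1 := Primrec.succ.comp primrec_toNat
  refine primrecPred_exists_lt (primrec_two_pow.comp (primrec_two_pow.comp hn)) <|
    (primrecPred_coherentFamily (hn.comp .fst) .snd).and <|
    primrecPred_exists_lt (primrec_two_pow.comp (hn.comp .fst)) ?_
  exact (primrecRel_testBit.comp (Primrec.snd.comp .fst) .snd).and
    (primrecRel_holds.comp .snd (Primrec.fst.comp .fst)).not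

theorem primrecPred_provable : PrimrecPred Provable :=
  primrecPred_hasCodedCountermodel.not.of_eq fun _ ↦
    not_iff_comm.1 not_provable_iff_hasCodedCountermodel

end RecFunLogic

/-- The modal logic `ℜ_d` is decidable: its set of theorems is a computable set of formulas. -/
theorem mainTheorem7 :
    ComputablePred (fun φ : RecFunLogic.Formula => RecFunLogic.Provable φ) :=
  RecFunLogic.primrecPred_provable.computablePred
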